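/- **Conventions.** A *manifold* is a second-countable Hausdorff finite-dimensional smooth manifold without boundary, with its usual diffeology (plots are the usual smooth maps). A subset of a diffeological space is *D-open* if its preimage under every plot is open; the D-open sets form the *D-topology*, and a space is *D-compact* if it is compact in this topology. Subsets and products carry the subspace and product diffeologies, and the set $\mathrm{C}^\infty(X,Y)$ of smooth maps carries the functional diffeology, in which $r\mapsto p(r)$ is a plot iff $(r,x)\mapsto p(r)(x)$ is smooth. A map $f:X\to Y$ of diffeological spaces is *étale* if every $x\in X$ has a D-open neighborhood $O$ that $f$ maps diffeomorphically onto a D-open neighborhood $O'$ of $f(x)$. A smooth map $f:X\to Y$ is a *diffeological étale map* if for every plot $P:U\to Y$ the pullback $P^*f:\{(r,x)\in U\times X: P(r)=f(x)\}\to U$, $(r,x)\mapsto r$, is étale. A *diffeological étale $n$-manifold* is a diffeological space $\mathcal M$ covered by the images of a family of diffeological étale maps from open subsets of $\mathbb R^n$ into $\mathcal M$; one writes $\dim\mathcal M=n$. The *internal tangent space* $T_xX$ is the real vector space generated by the pairs $(p,v)$, where $p$ is a plot defined around $0\in\mathbb R^m$ with $p(0)=x$ and $v\in\mathbb R^m$,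 linearly in $v$, modulo $(q\circ g,v)\sim(q,dg_0(v))$ for smooth $g$ with $g(0)=0$ (the colimit of the tangent spaces at $0$ of the domains of the plots centred at $x$). A smooth map $f:X\to Y$ induces the internal tangent map $df_x:T_xX\to T_{f(x)}Y$, $[p,v]\mapsto[f\circ p,v]$. A smooth map $f:\mathcal K\to\mathcal M$ between diffeological étale manifolds has *full rank $k$* at $y\in\mathcal K$ if $\operatorname{rank} df_y=k$ and $k=\min\{\dim\mathcal K,\dim\mathcal M\}$. **Proposition 3.2.** Let $\mathcal L$ be a manifold, and let $\mathcal K$ and $\mathcal M$ be diffeological étale manifolds such that $\mathcal K$ is D-compact. Let $h:\mathcal L\to\mathrm{C}^\infty(\mathcal K,\mathcal M)$ be a smooth map. If $x_0\in\mathcal L$ and $h(x_0):\mathcal K\to\mathcal M$ has full rank $k$ at every point of $\mathcal K$, then there is a D-open neighborhood $O\subseteq\mathcal L$ of $x_0$ such that for every $x\in O$ the map $h(x):\mathcal K\to\mathcal M$ has full rank $k$ at every point of $\mathcal K$. -/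

import Mathlib

open Diffeology Topology TopologicalSpace
open scoped ContDiff Manifold DirectSum

namespace EtaleMfd

/-- The Euclidean space `ℝⁿ`. -/
abbrev Euc (n : ℕ) : Type := EuclideanSpace ℝ (Fin n)

section Diffeologies

variable {X Y : Type*} [DiffeologicalSpace X] [DiffeologicalSpace Y]

/-- The subspace diffeology: a map into a subset is a plot iff it is a plot of the ambient space.
In particular an open subset of `ℝⁿ` carries its usual diffeology. -/
instance subspaceDiffeology (s : X → Prop) : DiffeologicalSpace {x : X // s x} where
  plots _ := {p | IsPlot fun r ↦ (p r : X)}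
  constant_plots x := isPlot_const (x := (x : X))
  plot_reparam hp hf := isPlot_reparam hp hf
  locality h := DiffeologicalSpace.locality fun r ↦ by
    obtain ⟨u, hu, hr, H⟩ := h r
    exact ⟨u, hu, hr, fun hf hfs ↦ H hf hfs⟩

/-- The product diffeology: a map into `X × Y` is a plot iff both components are plots. -/
instance productDiffeology : DiffeologicalSpace (X × Y) where
  plots _ := {p | IsPlot (fun r ↦ (p r).1) ∧ IsPlot (fun r ↦ (p r).2)}
  constant_plots x := ⟨isPlot_const, isPlot_const⟩
  plot_reparam hp hf := ⟨isPlot_reparam hp.1 hf, isPlot_reparam hp.2 hf⟩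
  locality h := by
    refine ⟨DiffeologicalSpace.locality fun r ↦ ?_, DiffeologicalSpace.locality fun r ↦ ?_⟩
    · obtain ⟨u, hu, hr, H⟩ := h r
      exact ⟨u, hu, hr, fun hf hfs ↦ (H hf hfs).1⟩
    · obtain ⟨u, hu, hr, H⟩ := h r
      exact ⟨u, hu, hr, fun hf hfs ↦ (H hf hfs).2⟩

variable (X Y) in
/-- The set `C^∞(X, Y)` of smooth maps between diffeological spaces. -/
@[ext]
structure SmoothMap where
  /-- the underlying map -/
  toFun : X → Y
  smooth : DSmooth toFun

instance : CoeFun (SmoothMap X Y) fun _ ↦ X → Y := ⟨SmoothMap.toFun⟩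

/-- The functional diffeology on `C^∞(X, Y)`: a family `r ↦ p r` is a plot iff the evaluation map
`(r, x) ↦ p r x` is smooth on the product `ℝⁿ × X`. -/
instance functionalDiffeology : DiffeologicalSpace (SmoothMap X Y) where
  plots n := {p | DSmooth fun q : Euc n × X ↦ p q.1 q.2}
  constant_plots f := fun _ _ hq ↦ hq.2.dSmooth_comp f.smooth
  plot_reparam {n m p f} hp hf := fun k q hq ↦
    hp k (fun r ↦ (f (q r).1, (q r).2)) ⟨hq.1.dSmooth_comp hf.dSmooth, hq.2⟩
  locality {n p} h := fun k q hq ↦ DiffeologicalSpace.locality fun s ↦ by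
    obtain ⟨u, hu, hr, H⟩ := h (q s).1
    have hq1 : ContDiff ℝ ∞ fun s ↦ (q s).1 := hq.1.contDiff
    refine ⟨(fun s ↦ (q s).1) ⁻¹' u, hu.preimage hq1.continuous, hr, fun {j f} hf hfs ↦ ?_⟩
    have H' : DSmooth fun t : Euc j × X ↦ p ((q (f t.1)).1) t.2 :=
      H (f := fun t ↦ (q (f t)).1) (fun t ↦ hf t) (hq1.comp hfs)
    exact H' j (fun t ↦ (t, (q (f t)).2)) ⟨isPlot_id, isPlot_reparam hq.2 hfs⟩

end Diffeologies

/-- The standard diffeology of a smooth `l`-manifold (without boundary): its plots are the maps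
`ℝⁿ → L` that are smooth in the usual sense. -/
@[reducible]
def manifoldDiffeology (l : ℕ) (L : Type*) [TopologicalSpace L] [ChartedSpace (Euc l) L]
    [IsManifold (𝓡 l) ∞ L] : DiffeologicalSpace L where
  plots n := {p : Euc n → L | ContMDiff (𝓡 n) (𝓡 l) ∞ p}
  constant_plots _ := contMDiff_const
  plot_reparam hp hf := hp.comp hf.contMDiff
  locality {n p} h := fun x ↦ by
    obtain ⟨u, hu, hxu, H⟩ := h x
    obtain ⟨ε, hε, hεu⟩ := Metric.isOpen_iff.mp hu x hxu
    let b := OpenPartialHomeomorph.univBall x ε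
    have hbs : ∀ y, b y ∈ u := fun y ↦ hεu <| by
      have := b.map_source (x := y) (by simp [b])
      rwa [OpenPartialHomeomorph.univBall_target x hε] at this
    have h1 : ContMDiff (𝓡 n) (𝓡 l) ∞ (p ∘ b) :=
      H hbs OpenPartialHomeomorph.contDiff_univBall
    have h2 : ContDiffOn ℝ ∞ b.symm (Metric.ball x ε) :=
      OpenPartialHomeomorph.contDiffOn_univBall_symm
    have h3 : ContMDiffOn (𝓡 n) (𝓡 l) ∞ ((p ∘ b) ∘ b.symm) (Metric.ball x ε) :=
      h1.comp_contMDiffOn h2.contMDiffOn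
    have h4 : ContMDiffOn (𝓡 n) (𝓡 l) ∞ p (Metric.ball x ε) := h3.congr fun y hy ↦ by
      have : b (b.symm y) = y := b.right_inv (by
        rwa [OpenPartialHomeomorph.univBall_target x hε])
      simp [Function.comp, this]
    exact h4.contMDiffAt (Metric.ball_mem_nhds x hε)

section EtaleMaps

variable {X Y : Type*} [DiffeologicalSpace X] [DiffeologicalSpace Y]

/-- Diffeomorphisms of diffeological spaces: smooth maps with a smooth inverse. -/
def IsDiffeomorphism (f : X → Y) : Prop :=
  DSmooth f ∧ ∃ g : Y → X, DSmooth g ∧ Function.LeftInverse g f ∧ Function.RightInverse g f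

/-- Étale maps: every point `x` has a D-open neighbourhood `O` which `f` maps diffeomorphically
onto a D-open neighbourhood `O'` of `f x`. -/
def IsEtale (f : X → Y) : Prop :=
  ∀ x : X, ∃ (O : Set X) (O' : Set Y), IsOpen[dTopology] O ∧ x ∈ O ∧
    IsOpen[dTopology] O' ∧ f x ∈ O' ∧ ∃ hf : Set.MapsTo f O O', IsDiffeomorphism (hf.restrict f O O')

/-- Diffeological étale maps: smooth maps `f : X → Y` such that for every plot `P : U → Y`, with
`U` an open subset of some `ℝᵐ`, the pullback
`P*f : P*X = {(r, x) ∈ U × X | P r = f x} → U`, `(r, x) ↦ r`, is étale. -/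
def IsDiffeologicalEtale (f : X → Y) : Prop :=
  DSmooth f ∧ ∀ (m : ℕ) (U : Opens (Euc m)) (P : U → Y), DSmooth P →
    IsEtale (Function.Pullback.fst : Function.Pullback P f → U)

/-- Diffeological étale `n`-manifolds: diffeological spaces with an atlas, that is, a family of
diffeological étale maps from open subsets of `ℝⁿ` whose images cover the space. -/
def IsEtaleManifold (n : ℕ) (M : Type*) [DiffeologicalSpace M] : Prop :=
  ∃ 𝔄 : Set (Σ U : Opens (Euc n), U → M),
    (∀ φ ∈ 𝔄, IsDiffeologicalEtale φ.2) ∧ ∀ x : M, ∃ φ ∈ 𝔄, x ∈ Set.range φ.2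

end EtaleMaps

section InternalTangent

variable {X Y : Type*} [DiffeologicalSpace X] [DiffeologicalSpace Y]

/-- Plots `p : ℝⁿ → X` centred at `x`, i.e. with `p 0 = x`. -/
structure PointedPlot (x : X) where
  /-- the dimension of the domain -/
  dim : ℕ
  /-- the underlying map -/
  toFun : Euc dim → X
  isPlot : IsPlot toFun
  map_zero : toFun 0 = x

/-- The image of a pointed plot under a smooth map. -/
abbrev PointedPlot.push (f : SmoothMap X Y) {x : X} (p : PointedPlot x) : PointedPlot (f x) where
  dim := p.dim
  toFun r := f (p.toFun r)
  isPlot := p.isPlot.dSmooth_comp f.smooth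
  map_zero := by rw [p.map_zero]

open Classical in
/-- The relations `(p, v) ∼ (q, dg₀ v)` defining the internal tangent space, one for each smooth
`g : ℝᵐ → ℝⁿ` with `g 0 = 0` and `q ∘ g = p`. -/
noncomputable def tangentRelations (x : X) : Submodule ℝ (⨁ p : PointedPlot x, Euc p.dim) :=
  Submodule.span ℝ {w | ∃ (p q : PointedPlot x) (g : Euc p.dim → Euc q.dim) (v : Euc p.dim),
    ContDiff ℝ ∞ g ∧ g 0 = 0 ∧ q.toFun ∘ g = p.toFun ∧
    w = DirectSum.lof ℝ (PointedPlot x) (fun p ↦ Euc p.dim) p v -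
      DirectSum.lof ℝ (PointedPlot x) (fun p ↦ Euc p.dim) q (fderiv ℝ g 0 v)}

/-- The internal tangent space `T_x X`: the colimit of the tangent spaces `T₀ ℝⁿ = ℝⁿ` over the
category of plots centred at `x`, written as a direct sum modulo relations. (The plots on all of
`ℝⁿ` give the same colimit as those on arbitrary neighbourhoods of `0`, as small balls are
diffeomorphic to `ℝⁿ`.) -/
abbrev InternalTangentSpace (x : X) : Type _ :=
  (⨁ p : PointedPlot x, Euc p.dim) ⧸ tangentRelations x

open Classical in
/-- The map `(p, v) ↦ (f ∘ p, v)` before passing to quotients. -/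
noncomputable def preTangentMap (f : SmoothMap X Y) (x : X) :
    (⨁ p : PointedPlot x, Euc p.dim) →ₗ[ℝ] ⨁ p : PointedPlot (f x), Euc p.dim :=
  DirectSum.toModule ℝ (PointedPlot x) _ fun p ↦
    DirectSum.lof ℝ (PointedPlot (f x)) (fun p ↦ Euc p.dim) (p.push f)

theorem tangentRelations_le (f : SmoothMap X Y) (x : X) :
    tangentRelations x ≤ (tangentRelations (f x)).comap (preTangentMap f x) := by
  classical
  refine Submodule.span_le.2 ?_
  rintro _ ⟨p, q, g, v, hg, hg0, hpq, rfl⟩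
  refine Submodule.subset_span ⟨p.push f, q.push f, g, v, hg, hg0, ?_, ?_⟩
  · funext r
    exact congrArg f (congrFun hpq r)
  · rw [preTangentMap, map_sub, DirectSum.toModule_lof, DirectSum.toModule_lof]

/-- The internal tangent map `df_x : T_x X → T_{f x} Y`, `[p, v] ↦ [f ∘ p, v]`. -/
noncomputable def internalTangentMap (f : SmoothMap X Y) (x : X) :
    InternalTangentSpace x →ₗ[ℝ] InternalTangentSpace (f x) :=
  (tangentRelations x).mapQ (tangentRelations (f x)) (preTangentMap f x) (tangentRelations_le f x)

/-- `f` has internal rank `k` at `x`: the rank of `df_x` is `k`. -/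
def HasInternalRank (f : SmoothMap X Y) (x : X) (k : ℕ) : Prop :=
  LinearMap.rank (internalTangentMap f x) = k

/-- A smooth map `f` from a diffeological étale `m`-manifold to a diffeological étale `n`-manifold
has full rank `k` at `x`: its internal rank at `x` is `k`, and `k = min {m, n}`. -/
def HasFullRank {m n : ℕ} (_ : IsEtaleManifold m X) (_ : IsEtaleManifold n Y)
    (f : SmoothMap X Y) (k : ℕ) (x : X) : Prop :=
  HasInternalRank f x k ∧ k = min m n

end InternalTangent

end EtaleMfd

open EtaleMfd

/-! Having full rank is an open condition on matrices, and compactness of `K` makes it uniform over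
the points of `K`. The work lies in computing the internal rank by an ordinary derivative. Around
each point an étale manifold has a plot, not necessarily injective, through which every plot lifts
locally, and near a point the lift is determined by its value there (`IsEtalePlot`). Existence and
uniqueness of lifts make `v ↦ [p, v]` an isomorphism onto the tangent space. So if `q ∘ F = f ∘ p`
with `p`, `q` étale plots, then `f` at `p u` has the rank of the derivative of `F` at `u`
(`IsEtalePlot.hasInternalRank_iff`). For a family `H`, the map `(r, u) ↦ H r (p u)` lifts through
`q` jointly in both variables. The partial derivative of the lift in `u` is continuous in `(r, u)`,
so full rank persists on a product `V × V'` (`exists_nhds_hasInternalRank`). The images `p '' V'`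
are D-open; finitely many cover `K`, and the corresponding `V` are intersected. -/

namespace EtaleMfd

/-! ### Balls reparametrized by the whole space -/

open OpenPartialHomeomorph in
theorem univBall_mem {n : ℕ} (c : Euc n) {r : ℝ} (hr : 0 < r) (x : Euc n) :
    univBall c r x ∈ Metric.ball c r := by
  have := (univBall c r).map_source (x := x) (by simp)
  rwa [univBall_target c hr] at this

open OpenPartialHomeomorph in
theorem univBall_left_inv {n : ℕ} (c : Euc n) (r : ℝ) (x : Euc n) :
    (univBall c r).symm (univBall c r x) = x :=
  (univBall c r).left_inv (by simp)

open OpenPartialHomeomorph in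
theorem univBall_right_inv {n : ℕ} (c : Euc n) {r : ℝ} (hr : 0 < r) {y : Euc n}
    (hy : y ∈ Metric.ball c r) : univBall c r ((univBall c r).symm y) = y :=
  (univBall c r).right_inv (by rwa [univBall_target c hr])

theorem isPlot_iff_contDiff {n m : ℕ} {p : Euc n → Euc m} : IsPlot p ↔ ContDiff ℝ ∞ p :=
  IsContDiffCompatible.isPlot_iff

theorem isPlot_prod_iff {X Y : Type*} [DiffeologicalSpace X] [DiffeologicalSpace Y] {n : ℕ}
    {p : Euc n → X × Y} : IsPlot p ↔ IsPlot (fun r ↦ (p r).1) ∧ IsPlot (fun r ↦ (p r).2) := Iff.rfl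

/-! ### Étale plots and local lifting -/

variable {X Y : Type*} [DiffeologicalSpace X] [DiffeologicalSpace Y] {m n : ℕ}

/-- A plot through which every plot lifts locally, the lift being determined near a point by its
value there. -/
structure IsEtalePlot (p : Euc m → X) : Prop where
  isPlot : IsPlot p
  exists_lift : ∀ (d : ℕ) (q : Euc d → X), IsPlot q → ∀ (r : Euc d) (u : Euc m), q r = p u →
    ∃ (W : Set (Euc d)) (s : Euc d → Euc m), IsOpen W ∧ r ∈ W ∧ ContDiffOn ℝ ∞ s W ∧ s r = u ∧
      ∀ t ∈ W, p (s t) = q t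
  lift_unique : ∀ (d : ℕ) (W : Set (Euc d)) (r : Euc d) (s₁ s₂ : Euc d → Euc m), IsOpen W → r ∈ W →
    ContDiffOn ℝ ∞ s₁ W → ContDiffOn ℝ ∞ s₂ W → s₁ r = s₂ r → (∀ t ∈ W, p (s₁ t) = p (s₂ t)) →
    s₁ =ᶠ[𝓝 r] s₂

/-- Translations of étale plots are étale. -/
theorem IsEtalePlot.translate {p : Euc m → X} (hp : IsEtalePlot p) (a : Euc m) :
    IsEtalePlot fun u ↦ p (a + u) where
  isPlot := isPlot_reparam hp.isPlot (contDiff_const.add contDiff_id)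
  exists_lift d q hq r u hru := by
    obtain ⟨W, s, hW, hr, hs, hsr, h⟩ := hp.exists_lift d q hq r (a + u) hru
    exact ⟨W, fun t ↦ s t - a, hW, hr, hs.sub contDiffOn_const, by simp [hsr],
      fun t ht ↦ by simpa using h t ht⟩
  lift_unique d W r s₁ s₂ hW hr h₁ h₂ h₁₂ h := by
    filter_upwards [hp.lift_unique d W r (fun t ↦ a + s₁ t) (fun t ↦ a + s₂ t) hW hr
      (contDiffOn_const.add h₁) (contDiffOn_const.add h₂) (by simp [h₁₂]) h] with t ht
    exact add_left_cancel ht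

/-- Étale plots are D-open maps. -/
theorem IsEtalePlot.isOpen_image {p : Euc m → X} (hp : IsEtalePlot p) {V : Set (Euc m)}
    (hV : IsOpen V) : IsOpen[dTopology] (p '' V) := by
  refine isOpen_iff_preimages_plots.2 fun d q hq ↦ isOpen_iff_mem_nhds.2 ?_
  rintro r ⟨u, hu, hur⟩
  obtain ⟨W, s, hW, hr, hs, hsr, h⟩ := hp.exists_lift d q hq r u hur.symm
  have hc : ContinuousAt s r := (hs.continuousOn).continuousAt (hW.mem_nhds hr)
  filter_upwards [hW.mem_nhds hr, hc.preimage_mem_nhds (hV.mem_nhds (hsr ▸ hu))] with t ht ht'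
  exact ⟨s t, ht', h t ht⟩

open OpenPartialHomeomorph in
/-- A lift of a plot along a diffeological étale map. -/
theorem IsDiffeologicalEtale.exists_lift {f : X → Y} (hf : IsDiffeologicalEtale f) {d : ℕ}
    {q : Euc d → Y} (hq : IsPlot q) (r : Euc d) (x : X) (hr : q r = f x) :
    ∃ (δ : ℝ) (g : Euc d → X), 0 < δ ∧ IsPlot g ∧ g 0 = x ∧ ∀ t, f (g t) = q (univBall r δ t) := by
  have hP : DSmooth fun t : (⊤ : Opens (Euc d)) ↦ q t := fun _ p hp ↦ hq.dSmooth _ _ hp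
  obtain ⟨O, O', -, hxO, hO', hrO', hmaps, -, g, hg, hgl, hgr⟩ :=
    hf.2 d ⊤ _ hP ⟨(⟨r, trivial⟩, x), hr⟩
  have hι : IsPlot fun t : Euc d ↦ (⟨t, trivial⟩ : (⊤ : Opens (Euc d))) :=
    isPlot_iff_contDiff.2 contDiff_id
  obtain ⟨δ, hδ, hball⟩ := Metric.isOpen_iff.1 (isOpen_iff_preimages_plots.1 hO' d _ hι) r hrO'
  -- Plots are defined on whole Euclidean spaces, so the local section `g` is precomposed with a
  -- parametrization of a ball inside `O'`.
  let β : Euc d → O' := fun t ↦ ⟨⟨univBall r δ t, trivial⟩, hball (univBall_mem r hδ t)⟩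
  have hβ : IsPlot β := isPlot_iff_contDiff.2 contDiff_univBall
  have hgβ : IsPlot (g ∘ β) := hβ.dSmooth_comp hg
  refine ⟨δ, fun t ↦ (g (β t)).1.1.2, hδ, (isPlot_prod_iff.1 hgβ).2, ?_, fun t ↦ ?_⟩
  · have : β 0 = hmaps.restrict _ _ _ ⟨⟨(⟨r, trivial⟩, x), hr⟩, hxO⟩ := by
      apply Subtype.ext; apply Subtype.ext
      exact univBall_apply_zero r δ
    simp only [this, hgl _]
  · have h1 := (g (β t)).1.2
    have h2 := congrArg (fun z : O' ↦ ((z : (⊤ : Opens (Euc d))) : Euc d)) (hgr (β t))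
    rw [← h1]
    exact congrArg q h2

/-- Lifts along diffeological étale maps are locally unique. -/
theorem IsDiffeologicalEtale.lift_unique {f : X → Y} (hf : IsDiffeologicalEtale f) {d : ℕ}
    {σ₁ σ₂ : Euc d → X} (h₁ : IsPlot σ₁) (h₂ : IsPlot σ₂) (r : Euc d) (hr : σ₁ r = σ₂ r)
    (h : ∀ t, f (σ₁ t) = f (σ₂ t)) : σ₁ =ᶠ[𝓝 r] σ₂ := by
  have hP : DSmooth fun t : (⊤ : Opens (Euc d)) ↦ f (σ₁ t) :=
    fun _ p hp ↦ (h₁.dSmooth_comp hf.1).dSmooth _ _ hp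
  obtain ⟨O, O', hO, hxO, -, -, hmaps, -, g, -, hgl, -⟩ :=
    hf.2 d ⊤ _ hP ⟨(⟨r, trivial⟩, σ₁ r), rfl⟩
  have hι : IsPlot fun t : Euc d ↦ (⟨t, trivial⟩ : (⊤ : Opens (Euc d))) :=
    isPlot_iff_contDiff.2 contDiff_id
  -- Both lifts become sections of the same pullback; near `r` they lie in `O`, where the projection
  -- is injective.
  let τ₁ : Euc d → Function.Pullback (fun t : (⊤ : Opens (Euc d)) ↦ f (σ₁ t)) f :=
    fun t ↦ ⟨(⟨t, trivial⟩, σ₁ t), rfl⟩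
  let τ₂ : Euc d → Function.Pullback (fun t : (⊤ : Opens (Euc d)) ↦ f (σ₁ t)) f :=
    fun t ↦ ⟨(⟨t, trivial⟩, σ₂ t), h t⟩
  have hτ₁ : IsPlot τ₁ := isPlot_prod_iff.2 ⟨hι, h₁⟩
  have hτ₂ : IsPlot τ₂ := isPlot_prod_iff.2 ⟨hι, h₂⟩
  have hr' : τ₂ r = τ₁ r := Subtype.ext (Prod.ext rfl hr.symm)
  filter_upwards [(isOpen_iff_preimages_plots.1 hO d _ hτ₁).mem_nhds (x := r) hxO,
    (isOpen_iff_preimages_plots.1 hO d _ hτ₂).mem_nhds (x := r)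
      (show τ₂ r ∈ O by rw [hr']; exact hxO)] with t ht₁ ht₂
  have := hgl.injective (a₁ := ⟨τ₁ t, ht₁⟩) (a₂ := ⟨τ₂ t, ht₂⟩) rfl
  exact congrArg (fun z : O ↦ z.1.1.2) this

open OpenPartialHomeomorph in
/-- A diffeological étale map on an open set, restricted to a ball and reparametrized by the whole
space, is an étale plot. -/
theorem IsDiffeologicalEtale.exists_isEtalePlot {U : Opens (Euc m)} {f : U → X}
    (hf : IsDiffeologicalEtale f) (u : U) : ∃ p : Euc m → X, IsEtalePlot p ∧ p 0 = f u := by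
  obtain ⟨ε, hε, hU⟩ := Metric.isOpen_iff.1 U.isOpen u u.2
  let b : Euc m → U := fun t ↦ ⟨univBall (u : Euc m) ε t, hU (univBall_mem _ hε t)⟩
  have hb : IsPlot b := isPlot_iff_contDiff.2 contDiff_univBall
  refine ⟨f ∘ b, ⟨hb.dSmooth_comp hf.1, fun d q hq r v hv ↦ ?_,
    fun d W r s₁ s₂ hW hr h₁ h₂ h₁₂ h ↦ ?_⟩, congrArg f (Subtype.ext (univBall_apply_zero _ _))⟩
  · obtain ⟨δ, g, hδ, hg, hg0, hgq⟩ := hf.exists_lift hq r (b v) hv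
    have hg' : ContDiff ℝ ∞ fun t ↦ (g t : Euc m) := isPlot_iff_contDiff.1 hg
    have hγ : ContDiffOn ℝ ∞ (fun t ↦ (g ((univBall r δ).symm t) : Euc m)) (Metric.ball r δ) :=
      hg'.comp_contDiffOn contDiffOn_univBall_symm
    -- The domain is cut down so that the lift stays in the ball on which the inverse of `univBall`
    -- is smooth.
    refine ⟨Metric.ball r δ ∩
      (fun t ↦ (g ((univBall r δ).symm t) : Euc m)) ⁻¹' Metric.ball (u : Euc m) ε,
      fun t ↦ (univBall (u : Euc m) ε).symm (g ((univBall r δ).symm t)),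
      hγ.continuousOn.isOpen_inter_preimage Metric.isOpen_ball Metric.isOpen_ball,
      ⟨Metric.mem_ball_self hδ, ?_⟩, ?_, ?_, ?_⟩
    · simp only [Set.mem_preimage, univBall_symm_apply_center, hg0]
      exact univBall_mem _ hε v
    · exact contDiffOn_univBall_symm.comp (hγ.mono Set.inter_subset_left) fun t ht ↦ ht.2
    · simp only [univBall_symm_apply_center, hg0]
      exact univBall_left_inv _ _ v
    · rintro t ⟨ht, ht'⟩
      have : b ((univBall (u : Euc m) ε).symm (g ((univBall r δ).symm t))) =
          g ((univBall r δ).symm t) := Subtype.ext (univBall_right_inv _ hε ht')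
      rw [Function.comp_apply, this, hgq, univBall_right_inv _ hδ ht]
  · obtain ⟨δ, hδ, hball⟩ := Metric.isOpen_iff.1 hW r hr
    have key : ∀ s : Euc d → Euc m, ContDiffOn ℝ ∞ s W →
        IsPlot fun t ↦ b (s (univBall r δ t)) := fun s hs ↦
      isPlot_reparam hb (hs.comp_contDiff contDiff_univBall
        fun t ↦ hball (univBall_mem _ hδ t))
    have hev := hf.lift_unique (key s₁ h₁) (key s₂ h₂) 0
      (by simp [univBall_apply_zero, h₁₂]) fun t ↦ h _ (hball (univBall_mem _ hδ t))
    have hc : Filter.Tendsto (univBall r δ).symm (𝓝 r) (𝓝 0) := by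
      have := (continuousOn_univBall_symm r δ).continuousAt (Metric.ball_mem_nhds r hδ)
      rwa [ContinuousAt, univBall_symm_apply_center] at this
    filter_upwards [hc.eventually hev, Metric.ball_mem_nhds r hδ] with t ht htb
    rw [univBall_right_inv _ hδ htb] at ht
    have := congrArg (fun z : U ↦ (univBall (u : Euc m) ε).symm z) ht
    simpa only [b, univBall_left_inv] using this

theorem IsEtaleManifold.exists_isEtalePlot (hX : IsEtaleManifold m X) (x : X) :
    ∃ p : Euc m → X, IsEtalePlot p ∧ p 0 = x := by
  obtain ⟨𝔄, h𝔄, hcov⟩ := hX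
  obtain ⟨φ, hφ, u, rfl⟩ := hcov x
  exact (h𝔄 φ hφ).exists_isEtalePlot u

/-! ### Tangent spaces in étale plots -/

open Classical in
/-- The linear map `v ↦ [p, v]`. -/
noncomputable def PointedPlot.tangentVec {x : X} (p : PointedPlot x) :
    Euc p.dim →ₗ[ℝ] InternalTangentSpace x :=
  (tangentRelations x).mkQ ∘ₗ DirectSum.lof ℝ (PointedPlot x) (fun p ↦ Euc p.dim) p

theorem PointedPlot.tangentVec_eq {x : X} {p q : PointedPlot x} {g : Euc p.dim → Euc q.dim}
    (hg : ContDiff ℝ ∞ g) (hg0 : g 0 = 0) (h : q.toFun ∘ g = p.toFun) (v : Euc p.dim) :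
    p.tangentVec v = q.tangentVec (fderiv ℝ g 0 v) :=
  (Submodule.Quotient.eq _).2 (Submodule.subset_span ⟨p, q, g, v, hg, hg0, h, rfl⟩)

theorem internalTangentMap_tangentVec (f : SmoothMap X Y) {x : X} (p : PointedPlot x)
    (v : Euc p.dim) :
    internalTangentMap f x (p.tangentVec v) = (p.push f).tangentVec v := by
  classical
  simp only [internalTangentMap, PointedPlot.tangentVec, LinearMap.comp_apply,
    Submodule.mkQ_apply, Submodule.mapQ_apply, preTangentMap]
  erw [DirectSum.toModule_lof]

open OpenPartialHomeomorph in
/-- A plot that lifts near `0` through another plot represents the same tangent vectors as the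
latter. -/
theorem PointedPlot.tangentVec_eq_of_lift {x : X} {p q : PointedPlot x} {W : Set (Euc p.dim)}
    {s : Euc p.dim → Euc q.dim} (hW : IsOpen W) (h0 : 0 ∈ W) (hs : ContDiffOn ℝ ∞ s W)
    (hs0 : s 0 = 0) (h : ∀ t ∈ W, q.toFun (s t) = p.toFun t) (v : Euc p.dim) :
    p.tangentVec v = q.tangentVec (fderiv ℝ s 0 v) := by
  obtain ⟨δ, hδ, hball⟩ := Metric.isOpen_iff.1 hW 0 h0
  let b : Euc p.dim → Euc p.dim := univBall (0 : Euc p.dim) δ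
  have hb : ContDiff ℝ ∞ b := contDiff_univBall
  have hb0 : b 0 = 0 := univBall_apply_zero _ _
  have hbW : ∀ t, b t ∈ W := fun t ↦ hball (univBall_mem _ hδ t)
  have hsb : ContDiff ℝ ∞ (s ∘ b) := hs.comp_contDiff hb hbW
  have hd : DifferentiableAt ℝ b 0 := hb.differentiable (by simp) 0
  have hds : DifferentiableAt ℝ s 0 := (hs.contDiffAt (hW.mem_nhds h0)).differentiableAt (by simp)
  have hc : ContDiffAt ℝ ∞ (univBall (0 : Euc p.dim) δ).symm 0 :=
    contDiffOn_univBall_symm.contDiffAt (Metric.ball_mem_nhds _ hδ)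
  have hright : ∀ w, fderiv ℝ b 0 (fderiv ℝ (univBall (0 : Euc p.dim) δ).symm 0 w) = w := by
    have hcomp : b ∘ (univBall (0 : Euc p.dim) δ).symm =ᶠ[𝓝 0] id := by
      filter_upwards [Metric.ball_mem_nhds 0 hδ] with t ht using univBall_right_inv _ hδ ht
    have h1 := hcomp.fderiv_eq (𝕜 := ℝ)
    have e0 : (univBall (0 : Euc p.dim) δ).symm 0 = 0 := univBall_symm_apply_center _ _
    rw [fderiv_comp 0 (by rw [e0]; exact hd) (hc.differentiableAt (by simp)), e0, fderiv_id] at h1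
    exact fun w ↦ DFunLike.congr_fun h1 w
  -- As `s` is smooth only on `W`, the two plots are compared through `p ∘ b`, which maps to `p` by
  -- `b` and to `q` by `s ∘ b`; `hright` then cancels the derivative of `b`.
  let pb : PointedPlot x := ⟨p.dim, p.toFun ∘ b, isPlot_reparam p.isPlot hb,
    by simp [hb0, p.map_zero]⟩
  have e1 := fun w ↦ PointedPlot.tangentVec_eq (p := pb) (q := p) hb hb0 rfl w
  have e2 := fun w ↦ PointedPlot.tangentVec_eq (p := pb) (q := q) (g := s ∘ b) hsb
    (by simp [hb0, hs0]) (funext fun t ↦ h _ (hbW t)) w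
  have hdsb : DifferentiableAt ℝ s (b 0) := by rwa [hb0]
  rw [fderiv_comp 0 hdsb hd, hb0] at e2
  have := (e1 (fderiv ℝ (univBall (0 : Euc p.dim) δ).symm 0 v)).symm.trans (e2 _)
  rwa [ContinuousLinearMap.comp_apply, hright] at this

/-- Lifting `q` through `p` turns each generator `[q, v]` into a vector of the form `[p, w]`. -/
theorem PointedPlot.tangentVec_surjective {x : X} {p : PointedPlot x}
    (hp : IsEtalePlot p.toFun) : Function.Surjective p.tangentVec := by
  classical
  intro z
  obtain ⟨z, rfl⟩ := (tangentRelations x).mkQ_surjective z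
  induction z using DirectSum.induction_on with
  | zero => exact ⟨0, by simp⟩
  | add y z hy hz =>
    obtain ⟨a, ha⟩ := hy
    obtain ⟨b, hb⟩ := hz
    exact ⟨a + b, by rw [map_add, map_add, ha, hb]⟩
  | of q v =>
    obtain ⟨W, s, hW, h0, hs, hs0, h⟩ :=
      hp.exists_lift q.dim q.toFun q.isPlot 0 0 (q.map_zero.trans p.map_zero.symm)
    refine ⟨fderiv ℝ s 0 v, ?_⟩
    rw [← tangentVec_eq_of_lift hW h0 hs hs0 h]
    simp only [tangentVec, LinearMap.comp_apply, DirectSum.lof_eq_of]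

/-- Differentiating chosen lifts through `p` gives a left inverse; uniqueness of lifts makes it
respect the relations. -/
theorem PointedPlot.tangentVec_injective {x : X} {p : PointedPlot x}
    (hp : IsEtalePlot p.toFun) : Function.Injective p.tangentVec := by
  classical
  choose W s hW h0 hs hs0 h using fun q : PointedPlot x ↦
    hp.exists_lift q.dim q.toFun q.isPlot 0 0 (q.map_zero.trans p.map_zero.symm)
  let Λ : (⨁ q : PointedPlot x, Euc q.dim) →ₗ[ℝ] Euc p.dim :=
    DirectSum.toModule ℝ (PointedPlot x) _ fun q ↦ (fderiv ℝ (s q) 0).toLinearMap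
  have hΛ : ∀ q v, Λ (DirectSum.lof ℝ (PointedPlot x) (fun q ↦ Euc q.dim) q v) =
      fderiv ℝ (s q) 0 v := fun q v ↦ DirectSum.toModule_lof ..
  have hle : tangentRelations x ≤ LinearMap.ker Λ := by
    refine Submodule.span_le.2 ?_
    rintro _ ⟨q, q', g, v, hg, hg0, hqq, rfl⟩
    rw [SetLike.mem_coe, LinearMap.mem_ker, map_sub, sub_eq_zero]
    have hg0W : (0 : Euc q.dim) ∈ g ⁻¹' W q' := by simpa [hg0] using h0 q'
    -- Both maps lift `q = q' ∘ g` through `p` and vanish at `0`, so they have the same germ.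
    have hev := hp.lift_unique q.dim (W q ∩ g ⁻¹' W q') 0 (s q) (s q' ∘ g)
      ((hW q).inter ((hW q').preimage hg.continuous)) ⟨h0 q, hg0W⟩
      ((hs q).mono Set.inter_subset_left)
      ((hs q').comp hg.contDiffOn fun t ht ↦ ht.2) (by simp [hs0, hg0]) (fun t ht ↦ by
        rw [h q t ht.1, Function.comp_apply, h q' _ ht.2, ← hqq]; rfl)
    have hd' : DifferentiableAt ℝ (s q') (g 0) := by
      rw [hg0]
      exact ((hs q').contDiffAt ((hW q').mem_nhds (h0 q'))).differentiableAt (by simp)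
    have hf := hev.fderiv_eq (𝕜 := ℝ)
    rw [fderiv_comp 0 hd' (hg.differentiable (by simp) 0), hg0] at hf
    refine (Eq.trans (by congr!) (hΛ q v)).trans (Eq.trans ?_ (Eq.trans (hΛ q' _).symm (by congr!)))
    rw [hf]; rfl
  have hsp : s p =ᶠ[𝓝 0] id := hp.lift_unique p.dim (W p) 0 (s p) id (hW p) (h0 p) (hs p)
    contDiffOn_id (hs0 p) (h p)
  refine Function.LeftInverse.injective (g := (tangentRelations x).liftQ Λ hle) fun v ↦ ?_
  simp only [tangentVec, LinearMap.comp_apply, Submodule.mkQ_apply, Submodule.liftQ_apply]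
  refine (Eq.trans (by congr!) (hΛ p v)).trans ?_
  rw [hsp.fderiv_eq, fderiv_id]; rfl

/-! ### Internal rank as the rank of a derivative -/

/-- If `F` represents `f` in étale plots centred at `x` and `f x`, then the internal rank of `f`
at `x` is the rank of the derivative of `F`. -/
theorem hasInternalRank_iff {f : SmoothMap X Y} {x : X} {p : PointedPlot x}
    {q : PointedPlot (f x)} (hp : IsEtalePlot p.toFun) (hq : IsEtalePlot q.toFun)
    {W : Set (Euc p.dim)} {F : Euc p.dim → Euc q.dim} (hW : IsOpen W) (h0 : 0 ∈ W)
    (hF : ContDiffOn ℝ ∞ F W) (hF0 : F 0 = 0) (h : ∀ t ∈ W, q.toFun (F t) = f (p.toFun t))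
    (k : ℕ) : HasInternalRank f x k ↔ (fderiv ℝ F 0).toLinearMap.rank = k := by
  let e := LinearEquiv.ofBijective p.tangentVec
    ⟨p.tangentVec_injective hp, p.tangentVec_surjective hp⟩
  let e' := LinearEquiv.ofBijective q.tangentVec
    ⟨q.tangentVec_injective hq, q.tangentVec_surjective hq⟩
  have hcomp : internalTangentMap f x ∘ₗ e.toLinearMap =
      e'.toLinearMap ∘ₗ (fderiv ℝ F 0).toLinearMap := LinearMap.ext fun v ↦
    (internalTangentMap_tangentVec f p v).trans
      (PointedPlot.tangentVec_eq_of_lift (p := p.push f) hW h0 hF hF0 h v)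
  have hrange : LinearMap.range (internalTangentMap f x) =
      (LinearMap.range (fderiv ℝ F 0).toLinearMap).map e'.toLinearMap := by
    rw [← LinearMap.range_comp, ← hcomp, LinearMap.range_comp_of_range_eq_top _ e.range]
  have hrank := (e'.submoduleMap (LinearMap.range (fderiv ℝ F 0).toLinearMap)).lift_rank_eq
  rw [← hrange] at hrank
  rw [HasInternalRank, LinearMap.rank, LinearMap.rank, ← Cardinal.lift_inj (b := (k : Cardinal)),
    ← Cardinal.lift_inj (a := Module.rank ℝ (LinearMap.range (fderiv ℝ F 0).toLinearMap)),
    Cardinal.lift_natCast, Cardinal.lift_natCast, ← hrank]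

/-- If `F` represents `f` in étale plots `p` and `q`, then the internal rank of `f` at `p u` is the
rank of the derivative of `F` at `u`. -/
theorem IsEtalePlot.hasInternalRank_iff {f : SmoothMap X Y} {p : Euc m → X} {q : Euc n → Y}
    (hp : IsEtalePlot p) (hq : IsEtalePlot q) {W : Set (Euc m)} {F : Euc m → Euc n}
    (hW : IsOpen W) (hF : ContDiffOn ℝ ∞ F W) (h : ∀ t ∈ W, q (F t) = f (p t))
    {u : Euc m} (hu : u ∈ W) (k : ℕ) :
    HasInternalRank f (p u) k ↔ (fderiv ℝ F u).toLinearMap.rank = k := by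
  let p' : PointedPlot (p u) := ⟨m, fun t ↦ p (u + t), (hp.translate u).isPlot, by simp⟩
  let q' : PointedPlot (f (p u)) :=
    ⟨n, fun t ↦ q (F u + t), (hq.translate (F u)).isPlot, by simp [h u hu]⟩
  have hadd : Continuous fun t : Euc m ↦ u + t := continuous_const.add continuous_id
  have hadd' : ContDiff ℝ ∞ fun t : Euc m ↦ u + t := contDiff_const.add contDiff_id
  have key := EtaleMfd.hasInternalRank_iff (f := f) (p := p') (q := q')
    (hp.translate u) (hq.translate (F u)) (W := (fun t ↦ u + t) ⁻¹' W)
    (F := fun t ↦ F (u + t) - F u) (hW.preimage hadd) (by simpa using hu)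
    ((hF.comp hadd'.contDiffOn fun t ht ↦ ht).sub contDiffOn_const) (by simp)
    (fun t ht ↦ by simpa [q', p'] using h _ ht) k
  rw [key, fderiv_sub_const, fderiv_comp_add_left, add_zero]

/-- A smooth family of maps of full rank at a point has full rank near this point. -/
theorem exists_nhds_hasInternalRank {l : ℕ} (hX : IsEtaleManifold m X) (hY : IsEtaleManifold n Y)
    {H : Euc l → SmoothMap X Y} (hH : IsPlot H) (y : X)
    (hy : HasInternalRank (H 0) y (min m n)) :
    ∃ (V : Set (Euc l)) (N : Set X), IsOpen V ∧ 0 ∈ V ∧ IsOpen[dTopology] N ∧ y ∈ N ∧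
      ∀ r ∈ V, ∀ z ∈ N, HasInternalRank (H r) z (min m n) := by
  obtain ⟨p, hp, rfl⟩ := hX.exists_isEtalePlot y
  obtain ⟨q, hq, hq0⟩ := hY.exists_isEtalePlot (H 0 (p 0))
  -- Parameter and point are merged into one Euclidean variable, so that a single lift is smooth in
  -- both.
  let E : Euc (l + m) ≃L[ℝ] Euc l × Euc m := ContinuousLinearEquiv.ofFinrankEq (by simp)
  have hG : IsPlot fun t ↦ H (E t).1 (p (E t).2) :=
    hH (l + m) (fun t ↦ ((E t).1, p (E t).2))
      ⟨isPlot_iff_contDiff.2 (show ContDiff ℝ ∞ fun t ↦ (E t).1 from contDiff_fst.comp E.contDiff),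
        isPlot_reparam hp.isPlot (contDiff_snd.comp E.contDiff)⟩
  obtain ⟨W, s, hW, h0, hs, -, h⟩ := hq.exists_lift (l + m) _ hG 0 0 (by simp [hq0])
  let ι (r : Euc l) (u : Euc m) : Euc (l + m) := E.symm (r, u)
  have hι (r : Euc l) : ContDiff ℝ ∞ (ι r) := E.symm.contDiff.comp (contDiff_prodMk_right r)
  have hW' (r : Euc l) : IsOpen (ι r ⁻¹' W) := hW.preimage (hι r).continuous
  let J : Euc m →L[ℝ] Euc (l + m) :=
    E.symm.toContinuousLinearMap ∘L ContinuousLinearMap.inr ℝ (Euc l) (Euc m)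
  have hD (r : Euc l) (u : Euc m) (hu : ι r u ∈ W) :
      fderiv ℝ (fun v ↦ s (ι r v)) u = fderiv ℝ s (ι r u) ∘L J := by
    have h1 : HasFDerivAt s (fderiv ℝ s (ι r u)) (ι r u) :=
      ((hs.contDiffAt (hW.mem_nhds hu)).differentiableAt (by simp)).hasFDerivAt
    have h2 : HasFDerivAt (ι r) J u :=
      E.symm.hasFDerivAt.comp u (hasFDerivAt_prodMk_right r u)
    exact (h1.comp u h2).fderiv
  have hrank (r : Euc l) (u : Euc m) (hu : ι r u ∈ W) :
      HasInternalRank (H r) (p u) (min m n) ↔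
        (fderiv ℝ s (ι r u) ∘L J).toLinearMap.rank = (min m n : ℕ) := by
    rw [← hD r u hu]
    exact hp.hasInternalRank_iff hq (hW' r) (hs.comp (hι r).contDiffOn fun t ht ↦ ht)
      (fun t ht ↦ by simpa [ι] using h _ ht) hu _
  have hopen : IsOpen (W ∩ (fun t ↦ fderiv ℝ s t ∘L J) ⁻¹'
      {A : Euc m →L[ℝ] Euc n | ((min m n : ℕ) : Cardinal) ≤ A.toLinearMap.rank}) := by
    refine ContinuousOn.isOpen_inter_preimage ?_ hW (isOpen_setOfPred_nat_le_rank (min m n))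
    exact (hs.continuousOn_fderiv_of_isOpen hW (by simp)).clm_comp continuousOn_const
  -- Rank is only lower semicontinuous; maximality of `min m n` turns the open condition `≥` into
  -- equality.
  have hle (A : Euc m →L[ℝ] Euc n) : A.toLinearMap.rank ≤ ((min m n : ℕ) : Cardinal) := by
    rw [Nat.mono_cast.map_min]
    refine le_min ?_ ?_
    · exact A.toLinearMap.rank_le_domain.trans_eq
        (by rw [← Module.finrank_eq_rank, finrank_euclideanSpace_fin])
    · exact A.toLinearMap.rank_le_range.trans_eq
        (by rw [← Module.finrank_eq_rank, finrank_euclideanSpace_fin])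
  have h00 : ι 0 0 = 0 := by simp [ι]
  have hmem := (hopen.preimage E.symm.continuous).mem_nhds (x := (0, 0))
    ⟨show ι 0 0 ∈ W by rwa [h00], ((hrank 0 0 (by rwa [h00])).1 hy).ge⟩
  obtain ⟨V, V', hV, hV0, hV', hV'0, hsub⟩ := mem_nhds_prod_iff'.1 hmem
  refine ⟨V, p '' V', hV, hV0, hp.isOpen_image hV', ⟨0, hV'0, rfl⟩, ?_⟩
  rintro r hr _ ⟨u, hu, rfl⟩
  have := hsub (Set.mk_mem_prod hr hu)
  exact (hrank r u this.1).2 (le_antisymm (hle _) this.2)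

/-! ### Charts of the parameter manifold and the compactness argument -/

open OpenPartialHomeomorph in
/-- Every point of a manifold is the image of `0` under a smooth open embedding of the model
space. -/
theorem exists_contMDiff_isOpenMap {l : ℕ} {L : Type*} [TopologicalSpace L]
    [ChartedSpace (Euc l) L] [IsManifold (𝓡 l) ∞ L] (x : L) :
    ∃ c : Euc l → L, ContMDiff (𝓡 l) (𝓡 l) ∞ c ∧ IsOpenMap c ∧ c 0 = x := by
  let e := chartAt (Euc l) x
  obtain ⟨ε, hε, hball⟩ := Metric.isOpen_iff.1 e.open_target (e x) (mem_chart_target _ x)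
  have hb (t : Euc l) : univBall (e x) ε t ∈ e.target := hball (univBall_mem _ hε t)
  have hsource : ((univBall (e x) ε).trans e.symm).source = Set.univ := by
    ext t; simp [hb]
  refine ⟨(univBall (e x) ε).trans e.symm, ?_, fun V hV ↦ ?_, ?_⟩
  · exact contMDiffOn_chart_symm.comp_contMDiff contDiff_univBall.contMDiff hb
  · exact OpenPartialHomeomorph.isOpen_image_of_subset_source _ hV (hsource ▸ V.subset_univ)
  · simp [e]

end EtaleMfd

theorem proposition3p2 {l m n : ℕ} {L K M : Type*}
    [TopologicalSpace L] [T2Space L] [SecondCountableTopology L]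
    [ChartedSpace (EuclideanSpace ℝ (Fin l)) L] [IsManifold (𝓡 l) ∞ L]
    [DiffeologicalSpace K] [DiffeologicalSpace M]
    (hK : IsEtaleManifold m K) (hM : IsEtaleManifold n M)
    (hKc : @CompactSpace K dTopology)
    (h : L → SmoothMap K M)
    (hh : @DSmooth L (SmoothMap K M) (manifoldDiffeology l L) functionalDiffeology h)
    (x₀ : L) (k : ℕ) (hx₀ : ∀ y : K, HasFullRank hK hM (h x₀) k y) :
    ∃ O : Set L, IsOpen[(manifoldDiffeology l L).dTopology] O ∧ x₀ ∈ O ∧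
      ∀ x ∈ O, ∀ y : K, HasFullRank hK hM (h x) k y := by
  have hopen {O : Set L} (hO : IsOpen O) : IsOpen[(manifoldDiffeology l L).dTopology] O :=
    (@isOpen_iff_preimages_plots L (manifoldDiffeology l L) O).2 fun d p hp ↦
      hO.preimage (ContMDiff.continuous (I := 𝓡 d) (I' := 𝓡 l) (n := ∞) hp)
  obtain ⟨c, hc, hcopen, rfl⟩ := exists_contMDiff_isOpenMap (l := l) x₀
  have hH : IsPlot fun r ↦ h (c r) := hh l c hc
  choose V N hV hV0 hN hyN hVN using fun y ↦ exists_nhds_hasInternalRank hK hM hH y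
    ((hx₀ y).2 ▸ (hx₀ y).1)
  let _ : TopologicalSpace K := dTopology
  obtain ⟨t, ht⟩ := isCompact_univ.elim_finite_subcover N hN fun y _ ↦
    Set.mem_iUnion.2 ⟨y, hyN y⟩
  refine ⟨c '' ⋂ y ∈ t, V y, hopen (hcopen _ (isOpen_biInter_finset fun y _ ↦ hV y)),
    ⟨0, Set.mem_iInter₂.2 fun y _ ↦ hV0 y, rfl⟩, ?_⟩
  rintro _ ⟨r, hr, rfl⟩ y
  obtain ⟨z, hz, hyz⟩ := Set.mem_iUnion₂.1 (ht (Set.mem_univ y))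
  -- The equality `k = min m n` comes from a point of `K`; for empty `K` there is nothing to show.
  have hk := (hx₀ y).2
  exact ⟨hk ▸ hVN z r (Set.mem_iInter₂.1 hr z hz) y hyz, hk⟩
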